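/- Let $G$ be a non-compact real reductive Lie group: $G$ has finitely many connected components, $\mathfrak g=[\mathfrak g,\mathfrak g]\oplus\mathfrak z(\mathfrak g)$ with $[\mathfrak g,\mathfrak g]$ semisimple, and $G$ carries a Cartan involution $\theta$, i.e. an involutive Lie group automorphism whose fixed point group $K$ is compact and such that, with $\mathfrak k$ and $\mathfrak p$ the $+1$ and $-1$ eigenspaces of $d\theta$ on $\mathfrak g$, the map $K\times\mathfrak p\to G$, $(k,v)\mapsto k\exp v$, is a diffeomorphism. Fix an $\mathrm{Ad}(K)$-invariant scalar product on $\mathfrak p$ and let $S(\mathfrak p)$ be its unit sphere. Let $\mathscr M$ be a Hausdorff topological space with a continuous $G$-action, with stabilizers $G_x$, and let $\Psi:\mathscr M\times G\to\mathbb R$ be a Kempf–Ness function for $(\mathscr M,G,K)$, i.e. for all $x\in\mathscr M$, $g,h\in G$, $k\in K$, $v\in\mathfrak p$, $t\in\mathbb R$: (P1) $\Psi(x,\cdot)$ is smooth on $G$; (P2) $\Psi(x,kg)=\Psi(x,g)$; (P3) $\frac{d^2}{dt^2}\Psi(x,\exp(tv))\ge 0$, and $\frac{d^2}{dt^2}\big|_{t=0}\Psi(x,\exp(tv))=0$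 if and only if $\exp(\mathbb R v)\subset G_x$; (P4) $\Psi(x,g)+\Psi(gx,h)=\Psi(x,hg)$; (P5) the gradient map $\mathfrak F:\mathscr M\to\mathfrak p^*$, $\langle\mathfrak F(x),v\rangle=\frac{d}{dt}\big|_{t=0}\Psi(x,\exp(tv))$, is continuous. Call $x\in\mathscr M$ stable if $Gx\cap\mathfrak F^{-1}(0)\ne\emptyset$ and the Lie algebra $\mathfrak g_x$ of $G_x$ is conjugate under $\mathrm{Ad}(G)$ to a subalgebra of $\mathfrak k$. Then: (a) for all $x\in\mathscr M$ and $v\in\mathfrak p$ the limit $\Lambda(x,v)=\lim_{t\to+\infty}\frac{d}{dt}\Psi(x,\exp(tv))$ exists in $(-\infty,+\infty]$; (b) the function $\Lambda:\mathscr M\times S(\mathfrak p)\to(-\infty,+\infty]$ is lower semicontinuous; (c) the set of stable points is open in $\mathscr M$. -/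

import Mathlib

open scoped Manifold ContDiff Topology
open Filter

noncomputable section

namespace KempfNess

/-! ### Real reductive Lie groups -/

section Group

/-- A smooth real Lie group is a Lie group of the finite regularity that Mathlib uses for its
Lie algebra. -/
instance lieGroup_minSmoothness {n : ℕ} {G : Type*} [TopologicalSpace G]
    [ChartedSpace (EuclideanSpace ℝ (Fin n)) G] [Group G] [LieGroup (𝓡 n) ∞ G] :
    LieGroup (𝓡 n) (minSmoothness ℝ 3) G :=
  LieGroup.of_le (m := minSmoothness ℝ 3) (n := ∞)
    (by simp only [minSmoothness_of_isRCLikeNormedField]; exact WithTop.coe_le_coe.2 (le_top : (3 : ℕ∞) ≤ ⊤))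

variable {n : ℕ} {G : Type*} [TopologicalSpace G]
  [ChartedSpace (EuclideanSpace ℝ (Fin n)) G] [Group G]

open Classical in
/-- The Lie group exponential map: `lieExp v = γ 1`, where `γ` is the integral curve, starting at
the identity, of the left-invariant vector field of `v`. (On a Hausdorff Lie group this curve
exists and is unique, so the default value is never used.) -/
def lieExp (v : GroupLieAlgebra (𝓡 n) G) : G :=
  if h : ∃ γ : ℝ → G, γ 0 = 1 ∧ IsMIntegralCurve γ
      (mulInvariantVectorField v : (g : G) → TangentSpace (𝓡 n) g)
  then h.choose 1 else 1

/-- The differential at the identity of a map `φ : G → G` with `φ 1 = 1`, as an endomorphism of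
the Lie algebra. -/
def diffOne (φ : G → G) : GroupLieAlgebra (𝓡 n) G →ₗ[ℝ] GroupLieAlgebra (𝓡 n) G :=
  (mfderiv (𝓡 n) (𝓡 n) φ 1).toLinearMap

/-- The adjoint representation of `G` on its Lie algebra. -/
def Ad (g : G) : GroupLieAlgebra (𝓡 n) G →ₗ[ℝ] GroupLieAlgebra (𝓡 n) G :=
  diffOne fun h => g * h * g⁻¹

/-- The Lie algebra `{v | exp (ℝ v) ⊆ H}` of a (closed) subgroup `H` of `G`. -/
def lieAlgebraOf (H : Subgroup G) : Set (GroupLieAlgebra (𝓡 n) G) :=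
  {v | ∀ t : ℝ, lieExp (t • v) ∈ H}

/-- The subgroup `K` of fixed points of an endomorphism `θ` of `G`. -/
def fixedSubgroup (θ : G →* G) : Subgroup G := θ.eqLocus (MonoidHom.id G)

/-- The `+1`-eigenspace `𝔨` of the differential of `θ`. -/
def kSpace (θ : G →* G) : Submodule ℝ (GroupLieAlgebra (𝓡 n) G) :=
  LinearMap.ker (diffOne (n := n) θ - LinearMap.id)

/-- The `-1`-eigenspace `𝔭` of the differential of `θ`. -/
def pSpace (θ : G →* G) : Submodule ℝ (GroupLieAlgebra (𝓡 n) G) :=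
  LinearMap.ker (diffOne (n := n) θ + LinearMap.id)

variable (n) in
/-- `θ` is a Cartan involution of `G`: an involutive automorphism of the Lie group `G`, with
compact fixed point group `K`, such that `K × 𝔭 → G`, `(k, v) ↦ k exp v`, is a diffeomorphism.
As `K` is an embedded submanifold of `G`, the last condition says that `exp` is smooth on `𝔭` and
that the map has a two-sided inverse `g ↦ (κ g, ν g)` whose components are smooth as maps to `G`
and to `𝔤` (a copy of `ℝⁿ`). -/
structure IsCartanInvolution (θ : G →* G) : Prop where
  involutive : Function.Involutive θ
  smooth : ContMDiff (𝓡 n) (𝓡 n) ∞ θ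
  isCompact_fixed : IsCompact (fixedSubgroup θ : Set G)
  smooth_exp : ContMDiffOn (𝓡 n) (𝓡 n) ∞
    (fun v : EuclideanSpace ℝ (Fin n) => (lieExp (n := n) v : G))
    {v | v ∈ pSpace (n := n) θ}
  cartan_decomposition : ∃ (κ : G → G) (ν : G → EuclideanSpace ℝ (Fin n)),
    ContMDiff (𝓡 n) (𝓡 n) ∞ κ ∧ ContMDiff (𝓡 n) (𝓡 n) ∞ ν ∧
    (∀ g, κ g ∈ fixedSubgroup θ ∧ ν g ∈ pSpace (n := n) θ ∧
      κ g * lieExp (n := n) (ν g) = g) ∧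
    ∀ k ∈ fixedSubgroup θ, ∀ v ∈ pSpace (n := n) θ,
      κ (k * lieExp v) = k ∧ ν (k * lieExp v) = v

variable (n) in
/-- `(G, θ)` is a non-compact real reductive Lie group with Cartan involution `θ`: `G` has finitely
many connected components, and its Lie algebra is the direct sum of its centre and its derived
algebra, which is semisimple. -/
structure IsNoncompactReductive [LieGroup (𝓡 n) ∞ G] (θ : G →* G) : Prop where
  noncompact : NoncompactSpace G
  finite_components : Finite (ConnectedComponents G)
  isCompl : IsCompl (LieAlgebra.derivedSeries ℝ (GroupLieAlgebra (𝓡 n) G) 1)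
    (LieAlgebra.center ℝ (GroupLieAlgebra (𝓡 n) G))
  semisimple : LieAlgebra.IsSemisimple ℝ
    (LieAlgebra.derivedSeries ℝ (GroupLieAlgebra (𝓡 n) G) 1)
  cartan : IsCartanInvolution n θ

/-- `B` is an `Ad(K)`-invariant scalar product on `𝔭`. -/
structure IsInvariantScalarProduct (θ : G →* G)
    (B : LinearMap.BilinForm ℝ (pSpace (n := n) θ)) : Prop where
  symm : ∀ v w, B v w = B w v
  pos : ∀ v, v ≠ 0 → 0 < B v v
  invariant : ∀ k ∈ fixedSubgroup θ, ∀ v w v' w' : pSpace (n := n) θ,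
    (v' : GroupLieAlgebra (𝓡 n) G) = Ad k v → (w' : GroupLieAlgebra (𝓡 n) G) = Ad k w →
    B v' w' = B v w

/-! ### Kempf-Ness functions and stability -/

variable {M : Type*} [TopologicalSpace M] [MulAction G M]

/-- The gradient map `𝔉 : M → 𝔭*`: `𝔉 x` is the restriction to `𝔭` of the differential of
`Ψ(x, ·)` at the identity, that is `⟨𝔉 x, v⟩ = d/dt|₀ Ψ(x, exp (t v))`. -/
def gradientMap (θ : G →* G) (Ψ : M → G → ℝ) (x : M) : pSpace (n := n) θ →L[ℝ] ℝ :=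
  (mfderiv (𝓡 n) 𝓘(ℝ, ℝ) (Ψ x) 1 : GroupLieAlgebra (𝓡 n) G →L[ℝ] ℝ).comp
    (pSpace (n := n) θ).subtypeL

variable (n) in
/-- `Ψ : M × G → ℝ` is a Kempf-Ness function for `(M, G, K)`. -/
structure IsKempfNessFunction (θ : G →* G) (Ψ : M → G → ℝ) : Prop where
  smooth : ∀ x, ContMDiff (𝓡 n) 𝓘(ℝ, ℝ) ∞ (Ψ x)
  left_invariant : ∀ x, ∀ k ∈ fixedSubgroup θ, ∀ g, Ψ x (k * g) = Ψ x g
  second_deriv_nonneg : ∀ x, ∀ v ∈ pSpace (n := n) θ, ∀ t : ℝ,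
    0 ≤ iteratedDeriv 2 (fun s : ℝ => Ψ x (lieExp (s • v))) t
  second_deriv_eq_zero_iff : ∀ x, ∀ v ∈ pSpace (n := n) θ,
    iteratedDeriv 2 (fun s : ℝ => Ψ x (lieExp (s • v))) 0 = 0 ↔
      ∀ s : ℝ, lieExp (s • v) ∈ MulAction.stabilizer G x
  cocycle : ∀ x g h, Ψ x g + Ψ (g • x) h = Ψ x (h * g)
  continuous_gradientMap : Continuous (gradientMap (n := n) θ Ψ)

/-- The function `t ↦ d/dt Ψ(x, exp (t v))`,
with values in `[-∞, +∞]`. -/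
def weightSlope (Ψ : M → G → ℝ) (x : M) (v : GroupLieAlgebra (𝓡 n) G) (t : ℝ) : EReal :=
  ((deriv (fun s : ℝ => Ψ x (lieExp (s • v))) t : ℝ) : EReal)

/-- `Λ(x, v) = lim_{t → +∞} d/dt Ψ(x, exp (t v))`, with values in `[-∞, +∞]`. -/
def Lam (Ψ : M → G → ℝ) (x : M) (v : GroupLieAlgebra (𝓡 n) G) : EReal :=
  limUnder atTop (weightSlope Ψ x v)

variable (n) in
/-- `x` is polystable if its orbit meets the zero set of the gradient map. -/
def IsPolystable (θ : G →* G) (Ψ : M → G → ℝ) (x : M) : Prop :=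
  ∃ y ∈ MulAction.orbit G x, gradientMap (n := n) θ Ψ y = 0

variable (n) in
/-- `x` is stable if it is polystable and the Lie algebra `𝔤ₓ` of its stabilizer is conjugate to a
subalgebra of `𝔨`, that is `Ad g (𝔤ₓ) ⊆ 𝔨` for some `g` (`Ad g` is an automorphism of `𝔤`, so
`Ad g (𝔤ₓ)` is always a subalgebra). -/
def IsStable (θ : G →* G) (Ψ : M → G → ℝ) (x : M) : Prop :=
  IsPolystable n θ Ψ x ∧
    ∃ g : G, ∀ v ∈ lieAlgebraOf (n := n) (MulAction.stabilizer G x), Ad g v ∈ kSpace (n := n) θ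

end Group

end KempfNess

end

noncomputable section

namespace KempfNess

/-! ### One-parameter subgroups and the exponential map. -/

section Exponential

/-! By (P3), Ψ(x, exp tv) is convex in t, so its slope is monotone and Λ is the supremum of the
slopes. By the cocycle identity the slope at time t is ⟨𝔉(exp(tv)x), v⟩, jointly continuous in (x,
v). Hence Λ is lower semicontinuous and never -∞.

For openness, stability is shown equivalent to `UniformlyPositive`, which is open since the unit
sphere is compact. The bridge is `ProperAlong`: it is equivalent to uniform positivity by convexity,
and it is invariant under moving x in its orbit. If x is stable, move to a zero y of 𝔉. A slope that
never becomes positive is identically 0 for t ≥ 0, so exp(ℝv) fixes y by (P3) and lies in a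
conjugate of K; as exp is proper on 𝔭, v = 0. Conversely, a proper Ψ(x, ·) has a minimum, where 𝔉
vanishes and the stabilizer lies in K. -/

lemma mfderiv_congr_apply {n : ℕ} {G : Type*} [TopologicalSpace G]
    [ChartedSpace (EuclideanSpace ℝ (Fin n)) G] {f f' : G → G} (h : f = f')
    (x : G) (v : EuclideanSpace ℝ (Fin n)) :
    (show EuclideanSpace ℝ (Fin n) from mfderiv (𝓡 n) (𝓡 n) f x v) =
      mfderiv (𝓡 n) (𝓡 n) f' x v := by
  subst h; rfl


lemma mulInvariantVectorField_one {n : ℕ} {G : Type*} [TopologicalSpace G]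
    [ChartedSpace (EuclideanSpace ℝ (Fin n)) G] [Group G] (v : GroupLieAlgebra (𝓡 n) G) :
    (mulInvariantVectorField v : (g : G) → TangentSpace (𝓡 n) g) 1 = v := by
  have h : ((1 : G) * ·) = (id : G → G) := by ext; simp
  refine (mfderiv_congr_apply h 1 v).trans ?_
  rw [mfderiv_id]
  rfl

variable {n : ℕ} {G : Type*} [TopologicalSpace G]
  [ChartedSpace (EuclideanSpace ℝ (Fin n)) G] [Group G] [LieGroup (𝓡 n) ∞ G]

lemma mdifferentiableAt_mul_left (a b : G) : MDifferentiableAt (𝓡 n) (𝓡 n) (a * ·) b :=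
  (contMDiff_mul_left (n := ∞)).contMDiffAt.mdifferentiableAt (by simp)

/-- A smooth endomorphism `φ` maps the left-invariant vector field of `v` to the one of `dφ v`. -/
lemma mfderiv_mulInvariantVectorField (φ : G →* G) (hφ : ContMDiff (𝓡 n) (𝓡 n) ∞ φ)
    (v : GroupLieAlgebra (𝓡 n) G) (g : G) :
    mfderiv (𝓡 n) (𝓡 n) φ g (mulInvariantVectorField v g) =
      mulInvariantVectorField (diffOne (n := n) φ v) (φ g) := by
  have hd : ∀ b : G, MDifferentiableAt (𝓡 n) (𝓡 n) φ b := fun b =>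
    hφ.contMDiffAt.mdifferentiableAt (by simp)
  have h1 := mfderiv_comp_apply_of_eq (I := 𝓡 n) (I' := 𝓡 n) (I'' := 𝓡 n) (x := (1 : G))
    (g := φ) (f := (g * ·)) (hd g) (mdifferentiableAt_mul_left g 1) (mul_one g) v
  have h2 := mfderiv_comp_apply_of_eq (I := 𝓡 n) (I' := 𝓡 n) (I'' := 𝓡 n) (x := (1 : G))
    (g := (φ g * ·)) (f := φ) (mdifferentiableAt_mul_left _ 1) (hd 1) (map_one φ) v
  have h3 : (φ ∘ (g * ·)) = ((φ g * ·) ∘ φ) := by ext x; simp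
  exact h1.symm.trans ((mfderiv_congr_apply h3 1 v).trans h2)

/-- Left translations preserve left-invariant vector fields. -/
lemma mfderiv_mul_left_mulInvariantVectorField (v : GroupLieAlgebra (𝓡 n) G) (g h : G) :
    mfderiv (𝓡 n) (𝓡 n) (g * ·) h (mulInvariantVectorField v h) =
      mulInvariantVectorField v (g * h) := by
  have h1 := mfderiv_comp_apply_of_eq (I := 𝓡 n) (I' := 𝓡 n) (I'' := 𝓡 n) (x := (1 : G))
    (g := (g * ·)) (f := (h * ·)) (mdifferentiableAt_mul_left g h)
    (mdifferentiableAt_mul_left h 1) (mul_one h) v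
  have h3 : ((g * ·) ∘ (h * ·) : G → G) = (g * h * ·) := by ext x; simp [mul_assoc]
  exact h1.symm.trans (mfderiv_congr_apply h3 1 v)

lemma contMDiff_one_mulInvariantVectorField (v : GroupLieAlgebra (𝓡 n) G) :
    ContMDiff (𝓡 n) (𝓡 n).tangent 1
      (fun g : G => (⟨g, mulInvariantVectorField v g⟩ : TangentBundle (𝓡 n) G)) :=
  (contMDiff_mulInvariantVectorField v).of_le (by
    simp only [minSmoothness_of_isRCLikeNormedField]; exact one_le_two)

lemma isMIntegralCurveOn_mul_left {v : GroupLieAlgebra (𝓡 n) G} {γ : ℝ → G} {s : Set ℝ}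
    (h : IsMIntegralCurveOn γ (mulInvariantVectorField v : (g : G) → TangentSpace (𝓡 n) g) s)
    (g : G) :
    IsMIntegralCurveOn (fun t => g * γ t)
      (mulInvariantVectorField v : (g : G) → TangentSpace (𝓡 n) g) s := by
  intro t ht
  refine ((mdifferentiableAt_mul_left g (γ t)).hasMFDerivAt.comp_hasMFDerivWithinAt t
    (h t ht)).congr_mfderiv (ContinuousLinearMap.ext fun (r : ℝ) => ?_)
  exact ((mfderiv (𝓡 n) (𝓡 n) (g * ·) (γ t)).map_smul r _).trans
    (congrArg (fun w : EuclideanSpace ℝ (Fin n) => (show ℝ from r) • w)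
      (mfderiv_mul_left_mulInvariantVectorField v g (γ t)))

lemma isMIntegralCurve_mul_left {v : GroupLieAlgebra (𝓡 n) G} {γ : ℝ → G}
    (h : IsMIntegralCurve γ (mulInvariantVectorField v : (g : G) → TangentSpace (𝓡 n) g))
    (g : G) :
    IsMIntegralCurve (fun t => g * γ t)
      (mulInvariantVectorField v : (g : G) → TangentSpace (𝓡 n) g) :=
  isMIntegralCurve_iff_isMIntegralCurveOn.2
    (isMIntegralCurveOn_mul_left (isMIntegralCurve_iff_isMIntegralCurveOn.1 h) g)

lemma isMIntegralCurve_map {v : GroupLieAlgebra (𝓡 n) G} {γ : ℝ → G}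
    (h : IsMIntegralCurve γ (mulInvariantVectorField v : (g : G) → TangentSpace (𝓡 n) g))
    (φ : G →* G) (hφ : ContMDiff (𝓡 n) (𝓡 n) ∞ φ) :
    IsMIntegralCurve (fun t => φ (γ t))
      (mulInvariantVectorField (diffOne (n := n) φ v) : (g : G) → TangentSpace (𝓡 n) g) := by
  intro t
  have hd : MDifferentiableAt (𝓡 n) (𝓡 n) φ (γ t) :=
    hφ.contMDiffAt.mdifferentiableAt (by simp)
  refine (hd.hasMFDerivAt.comp t (h t)).congr_mfderiv (ContinuousLinearMap.ext fun (r : ℝ) => ?_)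
  exact ((mfderiv (𝓡 n) (𝓡 n) φ (γ t)).map_smul r _).trans
    (congrArg (fun w : EuclideanSpace ℝ (Fin n) => (show ℝ from r) • w)
      (mfderiv_mulInvariantVectorField φ hφ v (γ t)))

variable [T2Space G]

/-- Left-invariant vector fields are complete. -/
lemma exists_isMIntegralCurve_mulInvariantVectorField (v : GroupLieAlgebra (𝓡 n) G) :
    ∃ γ : ℝ → G, γ 0 = 1 ∧ IsMIntegralCurve γ
      (mulInvariantVectorField v : (g : G) → TangentSpace (𝓡 n) g) := by
  obtain ⟨γ, h0, hγ⟩ := exists_isMIntegralCurveAt_of_contMDiffAt_boundaryless (I := 𝓡 n) (t₀ := 0)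
    (x₀ := (1 : G)) (contMDiff_one_mulInvariantVectorField v).contMDiffAt
  obtain ⟨ε, hε, h⟩ := isMIntegralCurveAt_iff'.1 hγ
  -- Left translates of the curve through 1 live for the same time ε at every point; this uniform
  -- lifetime gives completeness.
  refine exists_isMIntegralCurve_of_isMIntegralCurveOn
    (contMDiff_one_mulInvariantVectorField v) hε (fun x => ?_) 1
  refine ⟨fun t => x * γ t, by simp [h0], ?_⟩
  rw [Real.ball_eq_Ioo] at h
  simpa using isMIntegralCurveOn_mul_left h x

lemma lieExp_eq {v : GroupLieAlgebra (𝓡 n) G} {γ : ℝ → G} (h0 : γ 0 = 1)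
    (h : IsMIntegralCurve γ (mulInvariantVectorField v : (g : G) → TangentSpace (𝓡 n) g)) :
    lieExp v = γ 1 := by
  have hex := exists_isMIntegralCurve_mulInvariantVectorField v
  rw [lieExp, dif_pos hex]
  exact congrFun (isMIntegralCurve_Ioo_eq_of_contMDiff_boundaryless (t₀ := 0)
    (contMDiff_one_mulInvariantVectorField v) hex.choose_spec.2 h
    (hex.choose_spec.1.trans h0.symm)) 1

lemma lieExp_smul_eq {v : GroupLieAlgebra (𝓡 n) G} {γ : ℝ → G} (h0 : γ 0 = 1)
    (h : IsMIntegralCurve γ (mulInvariantVectorField v : (g : G) → TangentSpace (𝓡 n) g))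
    (t : ℝ) : lieExp (t • v) = γ t := by
  have h2 := h.comp_mul t
  rw [← mulInvariantVectorField_smul] at h2
  rw [lieExp_eq (by simp [h0]) h2]
  simp

lemma isMIntegralCurve_lieExp (v : GroupLieAlgebra (𝓡 n) G) :
    IsMIntegralCurve (fun t : ℝ => (lieExp (t • v) : G))
      (mulInvariantVectorField v : (g : G) → TangentSpace (𝓡 n) g) := by
  obtain ⟨γ, h0, h⟩ := exists_isMIntegralCurve_mulInvariantVectorField v
  rwa [show (fun t : ℝ => (lieExp (t • v) : G)) = γ from funext (lieExp_smul_eq h0 h)]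

lemma lieExp_zero : (lieExp (0 : GroupLieAlgebra (𝓡 n) G) : G) = 1 := by
  obtain ⟨γ, h0, h⟩ := exists_isMIntegralCurve_mulInvariantVectorField
    (0 : GroupLieAlgebra (𝓡 n) G)
  simpa [h0] using lieExp_smul_eq h0 h 0

lemma lieExp_add_smul (v : GroupLieAlgebra (𝓡 n) G) (s t : ℝ) :
    (lieExp ((s + t) • v) : G) = lieExp (s • v) * lieExp (t • v) := by
  have h1 := isMIntegralCurve_mul_left (isMIntegralCurve_lieExp v) (lieExp (s • v))
  have h2 := (isMIntegralCurve_lieExp v).comp_add s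
  have := congrFun (isMIntegralCurve_Ioo_eq_of_contMDiff_boundaryless (t₀ := 0)
    (contMDiff_one_mulInvariantVectorField v) h2 h1 (by simp [lieExp_zero])) t
  simpa [add_comm] using this

lemma lieExp_map (φ : G →* G) (hφ : ContMDiff (𝓡 n) (𝓡 n) ∞ φ)
    (v : GroupLieAlgebra (𝓡 n) G) :
    φ (lieExp v) = lieExp (diffOne (n := n) φ v) := by
  have h := isMIntegralCurve_map (isMIntegralCurve_lieExp v) φ hφ
  rw [lieExp_eq (by simp [lieExp_zero]) h]
  simp

lemma lieExp_Ad (g : G) (v : GroupLieAlgebra (𝓡 n) G) :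
    (lieExp (Ad g v) : G) = g * lieExp v * g⁻¹ := by
  have h := lieExp_map (n := n) (MulAut.conj g).toMonoidHom (by
    have : ContMDiff (𝓡 n) (𝓡 n) ∞ (fun h : G => g * h * g⁻¹) :=
      (contMDiff_const.mul contMDiff_id).mul contMDiff_const
    exact this) v
  exact h.symm

/-- The velocity of `t ↦ f (exp (t v))` at `0` is the differential of `f` at `1`, applied
to `v`. -/
lemma hasMFDerivAt_comp_lieExp_zero {F : Type*} [NormedAddCommGroup F] [NormedSpace ℝ F]
    {N : Type*} [TopologicalSpace N] [ChartedSpace F N]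
    {f : G → N} (hf : MDifferentiableAt (𝓡 n) 𝓘(ℝ, F) f 1)
    (v : GroupLieAlgebra (𝓡 n) G) :
    HasMFDerivAt 𝓘(ℝ, ℝ) 𝓘(ℝ, F) (fun t : ℝ => f (lieExp (t • v))) 0
      ((1 : ℝ →L[ℝ] ℝ).smulRight (show F from mfderiv (𝓡 n) 𝓘(ℝ, F) f 1 v)) := by
  -- The base point `lieExp (0 • v)` is only propositionally 1, so the tangent space is transported
  -- by generalizing over it.
  have key : ∀ g : G, 1 = g → ∃ h : MDifferentiableAt (𝓡 n) 𝓘(ℝ, F) f g,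
      (show F from mfderiv (𝓡 n) 𝓘(ℝ, F) f g (mulInvariantVectorField v g)) =
        mfderiv (𝓡 n) 𝓘(ℝ, F) f 1 v := by
    rintro _ rfl
    exact ⟨hf, by rw [mulInvariantVectorField_one]⟩
  obtain ⟨h, h2⟩ := key (lieExp ((0 : ℝ) • v)) (by rw [zero_smul, lieExp_zero])
  refine (h.hasMFDerivAt.comp (0 : ℝ) (isMIntegralCurve_lieExp v 0)).congr_mfderiv
    (ContinuousLinearMap.ext fun (r : ℝ) => ?_)
  exact ((mfderiv (𝓡 n) 𝓘(ℝ, F) f (lieExp ((0 : ℝ) • v))).map_smul r _).trans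
    (congrArg (fun w : F => (show ℝ from r) • w) h2)

lemma hasDerivAt_comp_lieExp_zero {f : G → ℝ} (hf : ContMDiff (𝓡 n) 𝓘(ℝ, ℝ) ∞ f)
    (v : GroupLieAlgebra (𝓡 n) G) :
    HasDerivAt (fun t : ℝ => f (lieExp (t • v)))
      ((mfderiv (𝓡 n) 𝓘(ℝ, ℝ) f 1 : GroupLieAlgebra (𝓡 n) G →L[ℝ] ℝ) v) 0 := by
  have key : ∀ (γ : ℝ → ℝ) (L : ℝ →L[ℝ] ℝ) (a : ℝ), L 1 = a →
      HasMFDerivAt 𝓘(ℝ, ℝ) 𝓘(ℝ, ℝ) γ 0 L → HasDerivAt γ a 0 := by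
    rintro γ L _ rfl h
    have h' : HasFDerivAt γ L 0 := hasMFDerivAt_iff_hasFDerivAt.1 h
    exact h'.hasDerivAt
  exact key _ _ _ (one_smul ℝ _)
    (hasMFDerivAt_comp_lieExp_zero (hf.contMDiffAt.mdifferentiableAt (by simp)) v)

/-- If an endomorphism fixes `exp (ℝ v)`, then its differential fixes `v`. -/
lemma diffOne_eq_self {φ : G →* G} (hφ : ContMDiff (𝓡 n) (𝓡 n) ∞ φ)
    {v : GroupLieAlgebra (𝓡 n) G} (h : ∀ t : ℝ, φ (lieExp (t • v)) = lieExp (t • v)) :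
    diffOne (n := n) φ v = v := by
  have h1 := hasMFDerivAt_comp_lieExp_zero (F := EuclideanSpace ℝ (Fin n)) (f := φ)
    (hφ.contMDiffAt.mdifferentiableAt (by simp)) v
  have h2 := hasMFDerivAt_comp_lieExp_zero (F := EuclideanSpace ℝ (Fin n)) (f := (id : G → G))
    mdifferentiableAt_id v
  have h3 : (fun t : ℝ => φ (lieExp (t • v))) = fun t : ℝ => id (lieExp (t • v)) := funext h
  have key : ∀ γ γ' : ℝ → G, γ = γ' → ∀ a b : EuclideanSpace ℝ (Fin n),
      HasMFDerivAt 𝓘(ℝ, ℝ) (𝓡 n) γ 0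
        ((1 : ℝ →L[ℝ] ℝ).smulRight a : ℝ →L[ℝ] EuclideanSpace ℝ (Fin n)) →
      HasMFDerivAt 𝓘(ℝ, ℝ) (𝓡 n) γ' 0
        ((1 : ℝ →L[ℝ] ℝ).smulRight b : ℝ →L[ℝ] EuclideanSpace ℝ (Fin n)) → a = b := by
    rintro γ _ rfl a b ha hb
    have : ((1 : ℝ →L[ℝ] ℝ).smulRight a : ℝ →L[ℝ] EuclideanSpace ℝ (Fin n)) =
        (1 : ℝ →L[ℝ] ℝ).smulRight b := hasMFDerivAt_unique ha hb
    have h1 := congrArg (fun f : ℝ →L[ℝ] EuclideanSpace ℝ (Fin n) => f 1) this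
    simpa using h1
  refine (key _ _ h3 _ _ h1 h2).trans ?_
  rw [mfderiv_id]
  rfl

end Exponential

/-! ### Convex functions of one variable. -/

section Convex

variable {f : ℝ → ℝ}

/-- The graph of a function with monotone derivative lies above its tangents. -/
lemma tangent_le (hf : Differentiable ℝ f) (hm : Monotone (deriv f)) (s t : ℝ) :
    f t + deriv f t * (s - t) ≤ f s := by
  rcases lt_trichotomy s t with h | rfl | h
  · obtain ⟨c, hc, hc'⟩ := exists_deriv_eq_slope f h hf.continuous.continuousOn
      hf.differentiableOn
    have h1 := hm hc.2.le
    rw [hc', div_le_iff₀ (by linarith)] at h1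
    linarith
  · simp
  · obtain ⟨c, hc, hc'⟩ := exists_deriv_eq_slope f h hf.continuous.continuousOn
      hf.differentiableOn
    have h1 := hm hc.1.le
    rw [hc', le_div_iff₀ (by linarith)] at h1
    linarith

/-- The derivative is squeezed to 0 on [0, t], and a one-sided derivative at 0 determines the second
derivative. -/
lemma iteratedDeriv_two_eq_zero (hf : ContDiff ℝ ∞ f) (hm : Monotone (deriv f)) {t : ℝ}
    (ht : 0 < t) (h0 : deriv f 0 = 0) (h1 : deriv f t ≤ 0) : iteratedDeriv 2 f 0 = 0 := by
  have hd : Differentiable ℝ (deriv f) :=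
    (contDiff_infty_iff_deriv.1 hf).2.differentiable (by simp)
  have hz : ∀ s ∈ Set.Icc 0 t, deriv f s = 0 := fun s hs =>
    le_antisymm ((hm hs.2).trans h1) (h0.symm.le.trans (hm hs.1))
  have hw : HasDerivWithinAt (deriv f) 0 (Set.Icc 0 t) 0 :=
    (hasDerivWithinAt_const (0 : ℝ) (Set.Icc 0 t) (0 : ℝ)).congr hz h0
  rw [iteratedDeriv_succ, iteratedDeriv_one]
  exact (uniqueDiffOn_Icc ht 0 ⟨le_rfl, ht.le⟩).eq_deriv _ (hd 0).hasDerivAt.hasDerivWithinAt hw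

end Convex

/-! ### The Cartan decomposition and Kempf–Ness functions along 𝔭. -/

section Reductive

lemma eq_zero_of_norm_smul_le {V : Type*} [NormedAddCommGroup V] [NormedSpace ℝ V] {v : V} {R : ℝ}
    (h : ∀ t : ℝ, 0 ≤ t → ‖t • v‖ ≤ R) : v = 0 := by
  by_contra hv
  have hv' := norm_pos_iff.2 hv
  have h0 := h 0 le_rfl
  simp only [zero_smul, norm_zero] at h0
  have h1 := h ((R + 1) / ‖v‖) (by positivity)
  rw [norm_smul, Real.norm_of_nonneg (by positivity), div_mul_cancel₀ _ hv'.ne'] at h1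
  linarith

variable {n : ℕ} {G : Type*} [TopologicalSpace G]
  [ChartedSpace (EuclideanSpace ℝ (Fin n)) G] [Group G]
  {θ : G →* G}

/-- The space `𝔭`, as a subspace of the normed space `ℝⁿ`. -/
def pPart (n : ℕ) {G : Type*} [TopologicalSpace G] [ChartedSpace (EuclideanSpace ℝ (Fin n)) G]
    [Group G] (θ : G →* G) : Submodule ℝ (EuclideanSpace ℝ (Fin n)) where
  carrier := {v | v ∈ pSpace (n := n) θ}
  add_mem' := (pSpace (n := n) θ).add_mem
  zero_mem' := (pSpace (n := n) θ).zero_mem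
  smul_mem' := fun c _ h => (pSpace (n := n) θ).smul_mem c h

/-- The exponential map on `𝔭`. -/
def pExp (v : pPart n θ) : G := lieExp (n := n) (v : EuclideanSpace ℝ (Fin n))

lemma IsCartanInvolution.continuous_pExp (hθ : IsCartanInvolution n θ) :
    Continuous (pExp : pPart n θ → G) :=
  hθ.smooth_exp.continuousOn.comp_continuous continuous_subtype_val fun v => v.2

/-- The Cartan decomposition `G = K exp 𝔭`. -/
lemma IsCartanInvolution.exists_mul_pExp (hθ : IsCartanInvolution n θ) (g : G) :
    ∃ k ∈ fixedSubgroup θ, ∃ v : pPart n θ, k * pExp v = g := by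
  obtain ⟨κ, ν, -, -, h, -⟩ := hθ.cartan_decomposition
  exact ⟨κ g, (h g).1, ⟨ν g, (h g).2.1⟩, (h g).2.2⟩

/-- Properness of exp on 𝔭: the continuous map ν recovers v from exp v. -/
lemma IsCartanInvolution.exists_norm_le (hθ : IsCartanInvolution n θ) {C : Set G}
    (hC : IsCompact C) : ∃ R : ℝ,
    ∀ v : pPart n θ, pExp v ∈ C → ‖v‖ ≤ R := by
  obtain ⟨κ, ν, -, hν, -, h⟩ := hθ.cartan_decomposition
  obtain ⟨R, hR⟩ := (hC.image hν.continuous).isBounded.exists_norm_le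
  refine ⟨R, fun v hv => hR _ ⟨_, hv, ?_⟩⟩
  have h1 := (h 1 (one_mem _) v.1 v.2).2
  rw [one_mul] at h1
  exact h1

variable {M : Type*} [TopologicalSpace M] [MulAction G M] {Ψ : M → G → ℝ}

lemma contDiff_kempfNess (hθ : IsCartanInvolution n θ) (hΨ : IsKempfNessFunction n θ Ψ)
    (x : M) (v : pPart n θ) :
    ContDiff ℝ ∞ fun s : ℝ => Ψ x (pExp (s • v)) := by
  have hl : ContDiff ℝ ∞ fun s : ℝ => s • (v : EuclideanSpace ℝ (Fin n)) :=
    contDiff_id.smul contDiff_const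
  have h1 := hθ.smooth_exp.comp_contMDiff hl.contMDiff fun s => (pPart n θ).smul_mem s v.2
  exact ((hΨ.smooth x).comp h1).contDiff

lemma IsKempfNessFunction.apply_one (hΨ : IsKempfNessFunction n θ Ψ) (x : M) : Ψ x 1 = 0 := by
  simpa using hΨ.cocycle x 1 1

/-- The gradient map, as a functional on the normed space `𝔭`. -/
def pGradient (n : ℕ) {G : Type*} [TopologicalSpace G]
    [ChartedSpace (EuclideanSpace ℝ (Fin n)) G] [Group G] {M : Type*} [TopologicalSpace M]
    [MulAction G M] (θ : G →* G) (Ψ : M → G → ℝ) (x : M) : pPart n θ →L[ℝ] ℝ :=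
  gradientMap (n := n) θ Ψ x

lemma continuous_pGradient (hΨ : IsKempfNessFunction n θ Ψ) : Continuous (pGradient n θ Ψ) :=
  hΨ.continuous_gradientMap

lemma IsCartanInvolution.eq_zero_of_forall_mem (hθ : IsCartanInvolution n θ) {C : Set G}
    (hC : IsCompact C) {v : pPart n θ}
    (h : ∀ t : ℝ, pExp (t • v) ∈ C) : v = 0 := by
  obtain ⟨R, hR⟩ := hθ.exists_norm_le hC
  exact eq_zero_of_norm_smul_le fun t _ => hR (t • v) (h t)

lemma monotone_deriv_kempfNess (hθ : IsCartanInvolution n θ) (hΨ : IsKempfNessFunction n θ Ψ)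
    (x : M) (v : pPart n θ) :
    Monotone (deriv fun s : ℝ => Ψ x (pExp (s • v))) := by
  refine monotone_of_deriv_nonneg
    ((contDiff_infty_iff_deriv.1 (contDiff_kempfNess hθ hΨ x v)).2.differentiable
      (by simp)) fun t => ?_
  have h := hΨ.second_deriv_nonneg x v.1 v.2 t
  rw [iteratedDeriv_succ, iteratedDeriv_one] at h
  exact h

lemma monotone_weightSlope (hθ : IsCartanInvolution n θ) (hΨ : IsKempfNessFunction n θ Ψ)
    (x : M) (v : pPart n θ) :
    Monotone (weightSlope (n := n) Ψ x v.1) := fun _ _ h =>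
  EReal.coe_le_coe_iff.2 (monotone_deriv_kempfNess hθ hΨ x v h)

lemma Lam_eq_iSup (hθ : IsCartanInvolution n θ) (hΨ : IsKempfNessFunction n θ Ψ)
    (x : M) (v : pPart n θ) :
    Lam (n := n) Ψ x v.1 = ⨆ t, weightSlope (n := n) Ψ x v.1 t :=
  (tendsto_atTop_iSup (monotone_weightSlope hθ hΨ x v)).limUnder_eq

/-- `Ψ(x, ·)` is proper along `𝔭`: sublevel sets of `v ↦ Ψ(x, exp v)` are bounded. -/
def ProperAlong (n : ℕ) {G : Type*} [TopologicalSpace G]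
    [ChartedSpace (EuclideanSpace ℝ (Fin n)) G] [Group G] {M : Type*}
    (θ : G →* G) (Ψ : M → G → ℝ) (x : M) : Prop :=
  ∀ c : ℝ, ∃ R : ℝ, ∀ v : pPart n θ,
    Ψ x (pExp v) ≤ c → ‖v‖ ≤ R

/-- Write exp(v)g = k exp w. The cocycle identity and K-invariance bound Ψ(x, exp w), hence w; so
exp v stays in the compact set K exp(ball) g⁻¹, and v is bounded. -/
lemma ProperAlong.smul [LieGroup (𝓡 n) ∞ G] (hθ : IsCartanInvolution n θ)
    (hΨ : IsKempfNessFunction n θ Ψ) {x : M} (h : ProperAlong n θ Ψ x) (g : G) : ProperAlong n θ Ψ (g • x) := by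
  intro c
  have : IsTopologicalGroup G := topologicalGroup_of_lieGroup (𝓡 n) ∞
  obtain ⟨R, hR⟩ := h (c + Ψ x g)
  have hC : IsCompact ((fun q : G × pPart n θ =>
      q.1 * pExp q.2 * g⁻¹) ''
      ((fixedSubgroup θ : Set G) ×ˢ Metric.closedBall 0 R)) :=
    (hθ.isCompact_fixed.prod (isCompact_closedBall 0 R)).image
      ((continuous_fst.mul (hθ.continuous_pExp.comp continuous_snd)).mul continuous_const)
  obtain ⟨R', hR'⟩ := hθ.exists_norm_le hC
  refine ⟨R', fun v hv => hR' v ?_⟩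
  obtain ⟨k, h1, w, h3⟩ := hθ.exists_mul_pExp (pExp v * g)
  refine ⟨(k, w), ⟨h1, mem_closedBall_zero_iff.2 (hR _ ?_)⟩, ?_⟩
  · have h4 := hΨ.cocycle x g (pExp v)
    rw [← h3, hΨ.left_invariant x _ h1] at h4
    linarith
  · exact mul_inv_eq_of_eq_mul h3

variable [LieGroup (𝓡 n) ∞ G] [T2Space G]

lemma pExp_zero : pExp (0 : pPart n θ) = 1 := lieExp_zero

lemma pExp_add_smul (v : pPart n θ) (s t : ℝ) :
    pExp ((s + t) • v) = pExp (s • v) * pExp (t • v) :=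
  lieExp_add_smul (n := n) (v : EuclideanSpace ℝ (Fin n)) s t

lemma IsCartanInvolution.lieExp_mem_fixedSubgroup (hθ : IsCartanInvolution n θ)
    {v : GroupLieAlgebra (𝓡 n) G} (hv : v ∈ kSpace (n := n) θ) :
    lieExp v ∈ fixedSubgroup θ := by
  have h : diffOne (n := n) θ v = v := by
    simpa [kSpace, sub_eq_zero] using hv
  exact (lieExp_map θ hθ.smooth v).trans (congrArg lieExp h)

lemma IsCartanInvolution.mem_kSpace (hθ : IsCartanInvolution n θ)
    {v : GroupLieAlgebra (𝓡 n) G} (h : ∀ t : ℝ, lieExp (t • v) ∈ fixedSubgroup θ) :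
    v ∈ kSpace (n := n) θ := by
  have : diffOne (n := n) θ v = v := diffOne_eq_self hθ.smooth h
  simpa [kSpace, sub_eq_zero] using this

/-- The cocycle identity turns time t at x into time 0 at exp(tv)x, up to an additive constant. -/
lemma hasDerivAt_kempfNess (hΨ : IsKempfNessFunction n θ Ψ)
    (x : M) (v : pPart n θ) (t : ℝ) :
    HasDerivAt (fun s : ℝ => Ψ x (pExp (s • v))) (pGradient n θ Ψ (pExp (t • v) • x) v) t := by
  have h : HasDerivAt (fun s : ℝ => Ψ (pExp (t • v) • x) (pExp (s • v)))
      (pGradient n θ Ψ (pExp (t • v) • x) v) 0 :=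
    hasDerivAt_comp_lieExp_zero (n := n) (hΨ.smooth _) (v : EuclideanSpace ℝ (Fin n))
  rw [← sub_self t] at h
  refine ((h.comp_sub_const t t).const_add (Ψ x (pExp (t • v)))).congr_of_eventuallyEq
    (.of_forall fun s => ?_)
  dsimp only
  rw [hΨ.cocycle, ← pExp_add_smul, sub_add_cancel]

lemma deriv_kempfNess (hΨ : IsKempfNessFunction n θ Ψ) (x : M) (v : pPart n θ) (t : ℝ) :
    deriv (fun s : ℝ => Ψ x (pExp (s • v))) t = pGradient n θ Ψ (pExp (t • v) • x) v :=
  (hasDerivAt_kempfNess hΨ x v t).deriv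

/-! ### Joint continuity of slopes and compactness of the sphere. -/

section ContinuousAction

variable [ContinuousSMul G M]

lemma continuous_deriv_kempfNess (hθ : IsCartanInvolution n θ)
    (hΨ : IsKempfNessFunction n θ Ψ) (t : ℝ) :
    Continuous fun q : M × pPart n θ =>
      deriv (fun s : ℝ => Ψ q.1 (pExp (s • q.2))) t := by
  simp only [deriv_kempfNess hΨ]
  have h1 : Continuous fun q : M × pPart n θ =>
      pExp (t • q.2) :=
    hθ.continuous_pExp.comp (continuous_snd.const_smul t)
  exact ((continuous_pGradient hΨ).comp (h1.smul continuous_fst)).clm_apply continuous_snd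

lemma lowerSemicontinuous_Lam (hθ : IsCartanInvolution n θ) (hΨ : IsKempfNessFunction n θ Ψ) :
    LowerSemicontinuous fun q : M × pPart n θ => Lam (n := n) Ψ q.1 q.2.1 := by
  simp only [Lam_eq_iSup hθ hΨ]
  exact lowerSemicontinuous_iSup fun t => (continuous_coe_real_ereal.comp
    (continuous_deriv_kempfNess hθ hΨ t)).lowerSemicontinuous

/-- A uniform weight condition: all slopes in unit directions are positive at one time. -/
def UniformlyPositive (n : ℕ) {G : Type*} [TopologicalSpace G]
    [ChartedSpace (EuclideanSpace ℝ (Fin n)) G] [Group G] {M : Type*}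
    (θ : G →* G) (Ψ : M → G → ℝ) (x : M) : Prop :=
  ∃ t : ℝ, ∀ v ∈ Metric.sphere (0 : pPart n θ) 1,
    0 < deriv (fun s : ℝ => Ψ x (pExp (s • v))) t

lemma isOpen_uniformlyPositive (hθ : IsCartanInvolution n θ)
    (hΨ : IsKempfNessFunction n θ Ψ) : IsOpen {x : M | UniformlyPositive n θ Ψ x} := by
  have hS : IsCompact (Metric.sphere (0 : pPart n θ) 1) := isCompact_sphere _ _
  simp only [UniformlyPositive, Set.ofPred_exists]
  refine isOpen_iUnion fun t => isOpen_iff_mem_nhds.2 fun x hx => ?_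
  have := hS.eventually_forall_of_forall_eventually (x₀ := x) (P := fun y v =>
    0 < deriv (fun s : ℝ => Ψ y (pExp (s • v))) t) fun v hv =>
      (continuous_deriv_kempfNess hθ hΨ t).continuousAt.eventually (lt_mem_nhds (hx v hv))
  exact this

/-- A Dini argument: the open sets of directions with positive slope at time t increase with t and
cover the compact sphere. -/
lemma uniformlyPositive_of_forall (hθ : IsCartanInvolution n θ)
    (hΨ : IsKempfNessFunction n θ Ψ) {x : M}
    (h : ∀ v : pPart n θ, v ≠ 0 → ∃ t,
      0 < deriv (fun s : ℝ => Ψ x (pExp (s • v))) t) :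
    UniformlyPositive n θ Ψ x := by
  have hS : IsCompact (Metric.sphere (0 : pPart n θ) 1) := isCompact_sphere _ _
  obtain ⟨t, ht⟩ := hS.elim_directed_cover
    (fun t : ℝ => {v : pPart n θ |
      0 < deriv (fun s : ℝ => Ψ x (pExp (s • v))) t})
    (fun t => isOpen_lt continuous_const
      ((continuous_deriv_kempfNess hθ hΨ t).comp (Continuous.prodMk_right x)))
    (fun v hv => by
      obtain ⟨t, ht⟩ := h v (ne_zero_of_mem_unit_sphere ⟨v, hv⟩)
      exact Set.mem_iUnion.2 ⟨t, ht⟩)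
    (Monotone.directed_le fun s t hst v hv =>
      lt_of_lt_of_le hv (monotone_deriv_kempfNess hθ hΨ x v hst))
  exact ⟨t, fun v hv => ht hv⟩

end ContinuousAction

/-- On every unit ray Ψ lies above its tangent at t, whose slope is at least δ > 0 and whose value
at t is at least b, uniformly in the direction. -/
lemma UniformlyPositive.properAlong [ContinuousSMul G M] (hθ : IsCartanInvolution n θ)
    (hΨ : IsKempfNessFunction n θ Ψ) {x : M} (h : UniformlyPositive n θ Ψ x) :
    ProperAlong n θ Ψ x := by
  obtain ⟨t, ht⟩ := h
  have hS : IsCompact (Metric.sphere (0 : pPart n θ) 1) := isCompact_sphere _ _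
  have hd : Continuous fun v : pPart n θ =>
      deriv (fun s : ℝ => Ψ x (pExp (s • v))) t :=
    (continuous_deriv_kempfNess hθ hΨ t).comp (Continuous.prodMk_right x)
  have hc : Continuous fun v : pPart n θ =>
      Ψ x (pExp (t • v)) :=
    (hΨ.smooth x).continuous.comp (hθ.continuous_pExp.comp (continuous_id.const_smul t))
  obtain ⟨δ, hδ, hδ'⟩ := hS.exists_forall_le' (a := 0) hd.continuousOn ht
  obtain ⟨b, hb⟩ := (hS.image hc).bddBelow
  intro c
  -- Beyond t + (c - b)/δ the tangents exceed c; the bound 1 makes v nonzero, and t lets the slope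
  -- bound be multiplied by ‖v‖ - t.
  refine ⟨max 1 (max t (t + (c - b) / δ)), fun v hv => ?_⟩
  by_contra! hlt
  obtain ⟨h1, h2, h3⟩ := by simpa only [max_lt_iff] using hlt
  have hv0 : 0 < ‖v‖ := one_pos.trans h1
  set w : pPart n θ := ‖v‖⁻¹ • v with hw
  have hwS : w ∈ Metric.sphere (0 : pPart n θ) 1 := by
    rw [mem_sphere_zero_iff_norm, hw, norm_smul, norm_inv, norm_norm, inv_mul_cancel₀ hv0.ne']
  have hvw : v = ‖v‖ • w := (smul_inv_smul₀ hv0.ne' v).symm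
  have h4 := tangent_le ((contDiff_kempfNess hθ hΨ x w).differentiable (by simp))
    (monotone_deriv_kempfNess hθ hΨ x w) ‖v‖ t
  rw [← hvw] at h4
  have h5 := hb ⟨w, hwS, rfl⟩
  have h6 := mul_le_mul_of_nonneg_right (hδ' w hwS) (sub_nonneg.2 h2.le)
  have h7 : (c - b) / δ < ‖v‖ - t := by linarith
  rw [div_lt_iff₀ hδ] at h7
  dsimp only at h4 h5
  linarith [mul_comm δ (‖v‖ - t)]

/-- If the slope along v is never positive, the tangent inequality at time 0 puts the whole ray in
the sublevel set at level 0. -/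
lemma ProperAlong.uniformlyPositive [ContinuousSMul G M] (hθ : IsCartanInvolution n θ)
    (hΨ : IsKempfNessFunction n θ Ψ) {x : M} (h : ProperAlong n θ Ψ x) :
    UniformlyPositive n θ Ψ x := by
  refine uniformlyPositive_of_forall hθ hΨ fun v hv => ?_
  by_contra! hle
  obtain ⟨R, hR⟩ := h 0
  refine hv (eq_zero_of_norm_smul_le fun t ht => hR (t • v) ?_)
  have h1 := tangent_le ((contDiff_kempfNess hθ hΨ x v).differentiable (by simp))
    (monotone_deriv_kempfNess hθ hΨ x v) 0 t
  simp only [zero_smul, pExp_zero, hΨ.apply_one] at h1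
  have h2 := mul_nonneg (neg_nonneg.2 (hle t)) ht
  linarith

lemma pExp_smul_mem_stabilizer (hθ : IsCartanInvolution n θ)
    (hΨ : IsKempfNessFunction n θ Ψ) {y : M} (hy : pGradient n θ Ψ y = 0)
    {v : pPart n θ} {t : ℝ} (ht : 0 < t)
    (h : deriv (fun s : ℝ => Ψ y (pExp (s • v))) t ≤ 0) (s : ℝ) :
    pExp (s • v) ∈ MulAction.stabilizer G y := by
  have h0 : deriv (fun s : ℝ => Ψ y (pExp (s • v))) 0 = 0 := by
    rw [deriv_kempfNess hΨ, zero_smul, pExp_zero, one_smul, hy]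
    rfl
  exact (hΨ.second_deriv_eq_zero_iff y v.1 v.2).1 (iteratedDeriv_two_eq_zero
    (contDiff_kempfNess hθ hΨ y v) (monotone_deriv_kempfNess hθ hΨ y v) ht h0 h) s

lemma IsStable.uniformlyPositive [ContinuousSMul G M] (hθ : IsCartanInvolution n θ)
    (hΨ : IsKempfNessFunction n θ Ψ) {x : M} (h : IsStable n θ Ψ x) :
    UniformlyPositive n θ Ψ x := by
  have : IsTopologicalGroup G := topologicalGroup_of_lieGroup (𝓡 n) ∞
  obtain ⟨⟨_, ⟨g, rfl⟩, hy⟩, a, ha⟩ := h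
  dsimp only at hy
  -- Uniform positivity returns from g • x to x by way of properness, which is orbit-invariant.
  suffices hp : UniformlyPositive n θ Ψ (g • x) by
    have := ((hp.properAlong hθ hΨ).smul hθ hΨ g⁻¹).uniformlyPositive hθ hΨ
    rwa [inv_smul_smul] at this
  refine uniformlyPositive_of_forall hθ hΨ fun v hv => ?_
  by_contra! hle
  have hst := pExp_smul_mem_stabilizer hθ hΨ hy one_pos (hle 1)
  let u : GroupLieAlgebra (𝓡 n) G := (v : EuclideanSpace ℝ (Fin n))
  have hst' : ∀ t : ℝ, lieExp (t • u) ∈ MulAction.stabilizer G (g • x) := hst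
  have hx : Ad g⁻¹ u ∈ lieAlgebraOf (n := n) (MulAction.stabilizer G x) := fun t => by
    rw [← map_smul, lieExp_Ad, MulAction.mem_stabilizer_iff, mul_smul, mul_smul, inv_inv,
      MulAction.mem_stabilizer_iff.1 (hst' t), inv_smul_smul]
  have hk := ha _ hx
  -- Since Ad(a)Ad(g⁻¹)v lies in 𝔨, the group exp(ℝv) lies in the conjugate of K by g a⁻¹.
  refine hv (hθ.eq_zero_of_forall_mem (C := (fun k => g * a⁻¹ * k * (g * a⁻¹)⁻¹) ''
    (fixedSubgroup θ : Set G)) (hθ.isCompact_fixed.image (by fun_prop)) fun t => ?_)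
  refine ⟨_, hθ.lieExp_mem_fixedSubgroup ((kSpace (n := n) θ).smul_mem t hk), ?_⟩
  dsimp only
  rw [← map_smul, ← map_smul, lieExp_Ad, lieExp_Ad]
  change _ = lieExp (t • u)
  group

/-! ### Minima of proper Kempf–Ness functions. -/

lemma pGradient_eq_zero (hΨ : IsKempfNessFunction n θ Ψ) {y : M} (h : ∀ g, 0 ≤ Ψ y g) :
    pGradient n θ Ψ y = 0 := by
  ext v
  have h1 := hasDerivAt_kempfNess hΨ y v 0
  rw [zero_smul, pExp_zero, one_smul] at h1
  refine IsLocalMin.hasDerivAt_eq_zero (.of_forall fun t => ?_) h1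
  simp only [zero_smul, pExp_zero, hΨ.apply_one]
  exact h _

/-- At a minimum of a proper Kempf-Ness function, the stabilizer is contained in `K`. -/
lemma ProperAlong.stabilizer_le (hθ : IsCartanInvolution n θ) (hΨ : IsKempfNessFunction n θ Ψ)
    {y : M} (hp : ProperAlong n θ Ψ y) (h : ∀ g, 0 ≤ Ψ y g) :
    MulAction.stabilizer G y ≤ fixedSubgroup θ := by
  -- On the stabilizer the nonnegative numbers Ψ(y, g) and Ψ(y, g⁻¹) add up to 0.
  have h0 : ∀ g ∈ MulAction.stabilizer G y, Ψ y g = 0 := fun g hg => by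
    have h1 := hΨ.cocycle y g g⁻¹
    rw [MulAction.mem_stabilizer_iff.1 hg, inv_mul_cancel, hΨ.apply_one] at h1
    linarith [h g, h g⁻¹]
  intro g hg
  obtain ⟨k, h1, v, h3⟩ := hθ.exists_mul_pExp g
  have h4 : Ψ y (pExp v) = 0 := by
    rw [← h0 g hg, ← h3, hΨ.left_invariant y _ h1]
  -- Ψ vanishes at time 1 and is nonnegative at 1/2, so the slope at 1/2 is at most 0.
  have h5 := tangent_le ((contDiff_kempfNess hθ hΨ y v).differentiable (by simp))
    (monotone_deriv_kempfNess hθ hΨ y v) 1 (1 / 2)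
  simp only [one_smul, h4] at h5
  have hst := pExp_smul_mem_stabilizer hθ hΨ (pGradient_eq_zero hΨ h) (v := v)
    (t := 1 / 2) (by norm_num)
    (by linarith [h (pExp ((1 / 2 : ℝ) • v))])
  obtain ⟨R, hR⟩ := hp 0
  have hv0 : v = 0 := eq_zero_of_norm_smul_le fun t _ => hR (t • v) (h0 _ (hst t)).le
  rw [hv0, pExp_zero, mul_one] at h3
  rwa [← h3]

/-- Properness gives a minimum over exp 𝔭, K-invariance makes it a minimum over G, and the cocycle
identity moves the minimizer to 1. -/
lemma ProperAlong.exists_nonneg (hθ : IsCartanInvolution n θ) (hΨ : IsKempfNessFunction n θ Ψ)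
    {x : M} (hp : ProperAlong n θ Ψ x) : ∃ g₀ : G, ∀ g, 0 ≤ Ψ (g₀ • x) g := by
  obtain ⟨R, hR⟩ := hp 0
  have h0 : Ψ x (pExp (0 : pPart n θ)) = 0 := by
    rw [pExp_zero, hΨ.apply_one]
  obtain ⟨w, -, hw⟩ := (isCompact_closedBall (0 : pPart n θ) R).exists_isMinOn
    ⟨0, mem_closedBall_zero_iff.2 (hR 0 h0.le)⟩
    ((hΨ.smooth x).continuous.comp hθ.continuous_pExp).continuousOn
  have hmin : ∀ v : pPart n θ, Ψ x (pExp w) ≤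
      Ψ x (pExp v) := fun v => by
    by_cases hv : Ψ x (pExp v) ≤ 0
    · exact hw (mem_closedBall_zero_iff.2 (hR v hv))
    · refine le_trans ?_ (not_le.1 hv).le
      exact (hw (mem_closedBall_zero_iff.2 (hR 0 h0.le))).trans h0.le
  refine ⟨pExp w, fun g => ?_⟩
  obtain ⟨k, h1, v, h3⟩ := hθ.exists_mul_pExp (g * pExp w)
  have h4 := hΨ.cocycle x (pExp w) g
  rw [← h3, hΨ.left_invariant x _ h1] at h4
  linarith [hmin v]

lemma ProperAlong.isStable (hθ : IsCartanInvolution n θ) (hΨ : IsKempfNessFunction n θ Ψ)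
    {x : M} (hp : ProperAlong n θ Ψ x) : IsStable n θ Ψ x := by
  obtain ⟨g, hg⟩ := hp.exists_nonneg hθ hΨ
  refine ⟨⟨g • x, ⟨g, rfl⟩, pGradient_eq_zero hΨ hg⟩, g, fun v hv => ?_⟩
  refine hθ.mem_kSpace fun t => (hp.smul hθ hΨ g).stabilizer_le hθ hΨ hg ?_
  rw [← map_smul, lieExp_Ad, MulAction.mem_stabilizer_iff, mul_smul, mul_smul, inv_smul_smul,
    MulAction.mem_stabilizer_iff.1 (hv t)]

/-- `x` is stable if and only if the slopes `d/dt Ψ(x, exp (t v))` in all unit directions are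
positive at some common time. -/
lemma isStable_iff_uniformlyPositive [ContinuousSMul G M] (hθ : IsCartanInvolution n θ)
    (hΨ : IsKempfNessFunction n θ Ψ) {x : M} :
    IsStable n θ Ψ x ↔ UniformlyPositive n θ Ψ x :=
  ⟨fun h => h.uniformlyPositive hθ hΨ, fun h => (h.properAlong hθ hΨ).isStable hθ hΨ⟩

end Reductive

end KempfNess

end

theorem mainTheorem9 {n : ℕ} {G : Type*} [TopologicalSpace G]
    [ChartedSpace (EuclideanSpace ℝ (Fin n)) G] [Group G] [LieGroup (𝓡 n) ∞ G] [T2Space G]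
    (θ : G →* G) (hG : KempfNess.IsNoncompactReductive n θ)
    (B : LinearMap.BilinForm ℝ (KempfNess.pSpace (n := n) θ))
    (hB : KempfNess.IsInvariantScalarProduct θ B)
    {M : Type*} [TopologicalSpace M] [T2Space M] [MulAction G M] [ContinuousSMul G M]
    (Ψ : M → G → ℝ) (hΨ : KempfNess.IsKempfNessFunction n θ Ψ) :
    (∀ (x : M) (v : KempfNess.pSpace (n := n) θ),
      Tendsto (KempfNess.weightSlope (n := n) Ψ x v) atTop (𝓝 (KempfNess.Lam (n := n) Ψ x v)) ∧
        KempfNess.Lam (n := n) Ψ x v ≠ ⊥) ∧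
    LowerSemicontinuous
      (fun q : M × {v : KempfNess.pSpace (n := n) θ // B v v = 1} =>
        KempfNess.Lam (n := n) Ψ q.1 (q.2 : KempfNess.pSpace (n := n) θ)) ∧
    IsOpen {x : M | KempfNess.IsStable n θ Ψ x} := by
  have hθ := hG.cartan
  refine ⟨fun x v => ?_, ?_, ?_⟩
  · rw [KempfNess.Lam_eq_iSup hθ hΨ x ⟨v.1, v.2⟩]
    refine ⟨tendsto_atTop_iSup (KempfNess.monotone_weightSlope hθ hΨ x ⟨v.1, v.2⟩), fun h => ?_⟩
    exact EReal.coe_ne_bot _ (iSup_eq_bot.1 h 0)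
  -- Semicontinuity holds on all of M × 𝔭, so it restricts to the unit sphere of B, whatever norm
  -- was used on 𝔭.
  · have hc : Continuous fun v : {v : KempfNess.pSpace (n := n) θ // B v v = 1} =>
        (⟨v.1.1, v.1.2⟩ : KempfNess.pPart n θ) :=
      (continuous_subtype_val.comp continuous_subtype_val).subtype_mk _
    have hc' : Continuous fun q : M × {v : KempfNess.pSpace (n := n) θ // B v v = 1} =>
        (q.1, (⟨q.2.1.1, q.2.1.2⟩ : KempfNess.pPart n θ)) :=
      continuous_fst.prodMk (hc.comp continuous_snd)
    have h := (KempfNess.lowerSemicontinuous_Lam hθ hΨ (M := M)).comp hc'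
    exact h
  · simp only [KempfNess.isStable_iff_uniformlyPositive hθ hΨ]
    exact KempfNess.isOpen_uniformlyPositive hθ hΨ
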